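/- For an integer $k\ge 1$ and real $0<q<1$ let $$S_k(q)=\sum_{m=1}^\infty \frac{1}{m^k}\,\frac{q^m}{1-q^m}.$$ Say that a series $\sum_m u_m$ has merit $a$ if $u_{m+1}/u_m\to e^{-\pi\sqrt a}$ as $m\to\infty$. For $n\ge 0$ let $$c_n=3^{4n+1}-2(-4)^{3n}-2^{4n},\qquad \mathcal H_n(z)=(-1)^{n+1}\sum_{m=0}^{n+1}z^{2m-1}\binom{2n+2}{2m}\mathcal B_{2m}\mathcal B_{2n+2-2m},$$ where $\mathcal B_j$ are the Bernoulli numbers and $z\in\mathbb C\setminus\{0\}$. Put $q_1=e^{-\pi}$. Then there are rational numbers $C_{k,d}$, for $k=4n+1$ with $n\ge 1$ and $d\in\{0,3,4,6,12\}$, such that for every $n\ge1$ and $k=4n+1$ the following hold. (i) The four series $S_k(q_1^d)$, $d\in\{3,4,6,12\}$, converge, and $$\zeta(k)=C_{k,0}\,\pi^k+\sum_{d\in\{3,4,6,12\}}C_{k,d}\,S_k(q_1^d).$$ (ii) The series $S_k(q_1^d)$ has merit $d^2$ for each $d\in\{3,4,6,12\}$, and the combined series with terms $u_m=\sum_{d\in\{3,4,6,12\}}C_{k,d}\,\frac{1}{m^k}\frac{q_1^{dm}}{1-q_1^{dm}}$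 has merit $9$. (iii) $c_n\neq0$, $C_{k,12}\ne0$, and $$C_{4n+1,12}=\frac{C_{4n+1,3}}{2^{4n}}=\left(1-\frac{2^{4n+1}+1}{(-4)^n}\right)\frac{2}{c_n},$$ $$\frac{C_{4n+1,6}}{C_{4n+1,12}}=-\left(2^{4n+1}+(-4)^n+1\right),\qquad \sum_{d\in\{3,4,6,12\}}C_{4n+1,d}=-2.$$ (iv) The coefficient of $\pi^k$ is determined by $$\frac{(4n)!\,(2n+1)(4n+3)}{2^{4n}}\,c_n\,C_{4n+1,0}=\frac{(4n+3)\,3^{4n}}{4n+1}\,\Im\left(2\mathcal H_{2n}\left(\frac{2+2i}{3}\right)+\mathcal H_{2n}\left(\frac{2i}{3}\right)\right).$$ -/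

import Mathlib

noncomputable section

/-- The `m`-th term (`m ≥ 1`) of the Lambert series `S_k(q)`. -/
def lambertTerm (k : ℕ) (q : ℝ) (m : ℕ) : ℝ :=
  1 / (m : ℝ) ^ k * (q ^ m / (1 - q ^ m))

/-- The Lambert series `S_k(q) = ∑_{m ≥ 1} m^{-k} q^m / (1 - q^m)`. -/
def lambertS (k : ℕ) (q : ℝ) : ℝ :=
  ∑' m : ℕ, lambertTerm k q (m + 1)

/-- A series with terms `u m` has merit `a` if the ratio of successive terms tends to
`exp (-π √a)`. -/
def HasMerit (u : ℕ → ℝ) (a : ℝ) : Prop :=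
  Filter.Tendsto (fun m => u (m + 1) / u m) Filter.atTop
    (nhds (Real.exp (-(Real.pi * Real.sqrt a))))

/-- The base `q₁ = exp (-π)`. -/
def qOne : ℝ := Real.exp (-Real.pi)

/-- The integer sequence `c_n = 3^{4n+1} - 2(-4)^{3n} - 2^{4n}`. -/
def cSeq (n : ℕ) : ℤ :=
  3 ^ (4 * n + 1) - 2 * (-4) ^ (3 * n) - 2 ^ (4 * n)

/-- `H_n(z) = (-1)^{n+1} ∑_{m=0}^{n+1} z^{2m-1} binom(2n+2, 2m) B_{2m} B_{2n+2-2m}`, where the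
`B_j` are the Bernoulli numbers. The exponent `2m - 1` is an integer, equal to `-1` at `m = 0`. -/
def HFun (n : ℕ) (z : ℂ) : ℂ :=
  (-1) ^ (n + 1) * ∑ m ∈ Finset.range (n + 2),
    z ^ (2 * (m : ℤ) - 1) * ((2 * n + 2).choose (2 * m) : ℂ) *
      ((bernoulli (2 * m) : ℚ) : ℂ) * ((bernoulli (2 * n + 2 - 2 * m) : ℚ) : ℂ)

end

/-! The source of the formula is Ramanujan's transformation of F(z) = ζ(2N+1)/2 + S_{2N+1}(e^{2πiz})
under z ↦ -1/z, valid in the whole upper half-plane (`lambert_transformation`). Up to the factor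
-2πi, F(z) is ∑ m^{-2N-1} π cot(πmz). Partial fractions of the cotangent turn this into an
absolutely convergent double series over (m, l), and expanding its summand in powers of z² exchanges
m and l. The leftover products ζ(2a)ζ(2b) are Bernoulli numbers by Euler, and they assemble to
H_N(z).

Take N = 2n and add the transformations at z = 2i/3 and z = (±2+2i)/3. On the left the nomes are the
three cube-root-of-unity multiples of e^{-4π/3}; their sum collapses to S(q₁⁴) and S(q₁¹²). On the
right they are q₁³ and ±i e^{-3π/2}; the pair collapses to S(-q₁³) and S(q₁⁶), and S(-q₁³) reduces
in the same way to S(q₁³), S(q₁⁶), S(q₁¹²). Both collapses are instances of `hasSum_hecke`. The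
factors z^{4n} are (16/81)^n and, twice, (-64/81)^n, so ζ(4n+1) appears with total coefficient
c_n/(2·81^n), nonzero because c_n is odd.

The three points are permuted by z ↦ -z̄, which makes the H-contribution purely imaginary before its
factor of i. Its imaginary part is rational because the points are Gaussian rationals. The merits
follow from asymptotics: the q₁³ term dominates as soon as its coefficient is nonzero. -/

/-- The Lambert series `S_k` at a complex argument. -/
noncomputable def complexLambert (k : ℕ) (x : ℂ) : ℂ :=
  ∑' m : ℕ+, 1 / (m : ℂ) ^ k * (x ^ (m : ℕ) / (1 - x ^ (m : ℕ)))

/-! ### The double series: absolute convergence and reciprocity -/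

theorem hasSum_pnat_zeta {k : ℕ} (hk : 1 < k) :
    HasSum (fun m : ℕ+ => 1 / (m : ℂ) ^ k) (riemannZeta k) := by
  have h : Summable (fun m : ℕ => 1 / (m : ℂ) ^ k) := by
    apply Summable.of_norm
    simpa using Real.summable_one_div_nat_pow.2 hk
  rw [zeta_nat_eq_tsum_of_gt_one hk]
  refine (PNat.coe_injective.hasSum_iff (fun m hm => ?_)).2 h.hasSum
  have : m = 0 := by
    by_contra h0
    exact hm ⟨⟨m, Nat.pos_of_ne_zero h0⟩, rfl⟩
  subst this
  simp [show k ≠ 0 by omega]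

theorem summable_pnat_pow {k : ℕ} (hk : 1 < k) :
    Summable (fun m : ℕ+ => ‖1 / (m : ℂ) ^ k‖) :=
  (hasSum_pnat_zeta hk).summable.norm

/-- Multiplying by the conjugate of z makes the az part real, so only b contributes to the imaginary
part. The bound is uniform in a; applied to both factors of m²z² - l² it dominates the double series
by a product of convergent ones. -/
theorem norm_mul_add_real_ge {z : ℂ} (hz : 0 < z.im) (a b : ℝ) :
    |b| * (z.im / ‖z‖) ≤ ‖a * z + b‖ := by
  have hz0 : 0 < ‖z‖ := norm_pos_iff.2 (by rintro rfl; simp at hz)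
  rw [← mul_div_assoc, div_le_iff₀ hz0]
  calc |b| * z.im = |((a * z + b) * (starRingEnd ℂ) z).im| := by
        rw [show ((a * z + b) * (starRingEnd ℂ) z).im = -(b * z.im) by simp; ring, abs_neg,
          abs_mul, abs_of_pos hz]
    _ ≤ ‖(a * z + b) * (starRingEnd ℂ) z‖ := Complex.abs_im_le_norm _
    _ = _ := by simp

theorem norm_quadratic_ge {z : ℂ} (hz : 0 < z.im) (m l : ℕ+) :
    (l : ℝ) ^ 2 * (z.im / ‖z‖) ^ 2 ≤ ‖(m : ℂ) ^ 2 * z ^ 2 - (l : ℂ) ^ 2‖ := by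
  have h1 := norm_mul_add_real_ge hz m l
  have h2 := norm_mul_add_real_ge hz m (-l)
  simp only [abs_neg, Nat.abs_cast] at h1 h2
  have h3 : (m : ℂ) ^ 2 * z ^ 2 - (l : ℂ) ^ 2 =
      (((m : ℕ) : ℝ) * z + ((l : ℕ) : ℝ)) * (((m : ℕ) : ℝ) * z + (-((l : ℕ) : ℝ) : ℝ)) := by
    push_cast; ring
  rw [h3, norm_mul, ← mul_pow, sq]
  have : 0 ≤ z.im / ‖z‖ := by positivity
  gcongr

theorem quadratic_ne_zero {z : ℂ} (hz : 0 < z.im) (m l : ℕ+) :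
    (m : ℂ) ^ 2 * z ^ 2 - (l : ℂ) ^ 2 ≠ 0 := by
  have hz0 : 0 < ‖z‖ := norm_pos_iff.2 (by rintro rfl; simp at hz)
  have h := norm_quadratic_ge hz m l
  have : 0 < (l : ℝ) ^ 2 * (z.im / ‖z‖) ^ 2 := by positivity
  exact norm_pos_iff.1 (this.trans_le h)

/-- The general term of the double series behind `∑ m^{-2N-1} cot (π m z)`. -/
noncomputable def doubleTerm (N : ℕ) (z : ℂ) (p : ℕ+ × ℕ+) : ℂ :=
  1 / (p.1 : ℂ) ^ (2 * N) * (1 / ((p.1 : ℂ) ^ 2 * z ^ 2 - (p.2 : ℂ) ^ 2))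

theorem summable_doubleTerm {N : ℕ} (hN : 1 ≤ N) {z : ℂ} (hz : 0 < z.im) :
    Summable (doubleTerm N z) := by
  have hz0 : 0 < ‖z‖ := norm_pos_iff.2 (by rintro rfl; simp at hz)
  have h1 := ((summable_pnat_pow (k := 2 * N) (by omega)).mul_of_nonneg
    (summable_pnat_pow (k := 2) (by omega)) (fun _ => norm_nonneg _)
    (fun _ => norm_nonneg _)).mul_right (((z.im / ‖z‖) ^ 2)⁻¹)
  refine Summable.of_norm_bounded h1 fun p => ?_
  rw [doubleTerm, norm_mul, mul_assoc]
  refine mul_le_mul_of_nonneg_left ?_ (norm_nonneg _)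
  have h := norm_quadratic_ge hz p.1 p.2
  have hp : 0 < (p.2 : ℝ) ^ 2 * (z.im / ‖z‖) ^ 2 := by positivity
  rw [norm_div, norm_one, norm_div, norm_one, norm_pow, one_div, one_div, ← mul_inv,
    Complex.norm_natCast]
  exact inv_anti₀ hp h

/-- Iterates 1/(a(aw-b)) = -1/(ab) + w/(b(aw-b)). Each use trades one factor 1/a for 1/b, until all
N powers have moved to b. -/
theorem inv_pow_mul_inv_sub_eq (N : ℕ) {a b w : ℂ} (ha : a ≠ 0) (hb : b ≠ 0)
    (h : a * w - b ≠ 0) :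
    1 / a ^ N * (1 / (a * w - b)) =
      -∑ j ∈ Finset.range N, w ^ j * (1 / a ^ (N - j) * (1 / b ^ (j + 1))) +
        w ^ N * (1 / b ^ N * (1 / (a * w - b))) := by
  induction N with
  | zero => simp
  | succ N ih =>
    have h1 : 1 / a ^ (N + 1) * (1 / (a * w - b)) =
        1 / a * (1 / a ^ N * (1 / (a * w - b))) := by
      rw [pow_succ]; field_simp
    have h2 : ∑ j ∈ Finset.range N, w ^ j * (1 / a ^ (N + 1 - j) * (1 / b ^ (j + 1))) =
        1 / a * ∑ j ∈ Finset.range N, w ^ j * (1 / a ^ (N - j) * (1 / b ^ (j + 1))) := by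
      rw [Finset.mul_sum]
      refine Finset.sum_congr rfl fun j hj => ?_
      rw [Nat.sub_add_comm (Finset.mem_range.1 hj).le, pow_succ]
      field_simp
    have h3 : 1 / a * (1 / (a * w - b)) = -(1 / a * (1 / b)) + w * (1 / b * (1 / (a * w - b))) := by
      field_simp; ring
    rw [h1, ih, Finset.sum_range_succ, h2]
    simp only [Nat.add_sub_cancel_left, pow_one]
    have h4 : 1 / a * (w ^ N * (1 / b ^ N * (1 / (a * w - b)))) =
        w ^ N * (1 / b ^ N) * (1 / a * (1 / (a * w - b))) := by ring
    rw [mul_add, h4, h3]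
    simp only [pow_succ, one_div, mul_inv]
    ring

theorem neg_one_div_im_pos {z : ℂ} (hz : 0 < z.im) : 0 < (-1 / z).im := by
  have hz0 : z ≠ 0 := by rintro rfl; simp at hz
  rw [neg_div, one_div, Complex.neg_im, Complex.inv_im]
  have := Complex.normSq_pos.2 hz0
  rw [neg_div, neg_neg]
  positivity

/-- The expansion above with a = m², b = l², w = z². Its remainder carries l^{-2N} and is, up to a
power of z, the double term at -1/z with m and l exchanged; the other terms separate into products
of even zeta values. -/
theorem tsum_doubleTerm_reciprocity {N : ℕ} (hN : 1 ≤ N) {z : ℂ} (hz : 0 < z.im) :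
    ∑' p, doubleTerm N z p =
      -∑ j ∈ Finset.range N, z ^ (2 * j) *
        (riemannZeta ((2 * (N - j) : ℕ)) * riemannZeta ((2 * (j + 1) : ℕ))) -
        z ^ (2 * N) / z ^ 2 * ∑' p, doubleTerm N (-1 / z) p := by
  have hz0 : z ≠ 0 := by rintro rfl; simp at hz
  have hz' := neg_one_div_im_pos hz
  have hterm : ∀ p : ℕ+ × ℕ+, doubleTerm N z p =
      -∑ j ∈ Finset.range N, z ^ (2 * j) *
        (1 / (p.1 : ℂ) ^ (2 * (N - j)) * (1 / (p.2 : ℂ) ^ (2 * (j + 1)))) -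
        z ^ (2 * N) / z ^ 2 * doubleTerm N (-1 / z) p.swap := by
    rintro ⟨m, l⟩
    have hm : (m : ℂ) ≠ 0 := by simp
    have hl : (l : ℂ) ≠ 0 := by simp
    have h := inv_pow_mul_inv_sub_eq N (pow_ne_zero 2 hm) (pow_ne_zero 2 hl)
      (quadratic_ne_zero hz m l)
    simp only [doubleTerm, Prod.swap, pow_mul]
    rw [h]
    refine (sub_neg_eq_add _ _).symm.trans ?_
    congr 1
    have hq := quadratic_ne_zero hz m l
    have hq' := quadratic_ne_zero hz' l m
    have e : (l : ℂ) ^ 2 * (-1 / z) ^ 2 - (m : ℂ) ^ 2 =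
      -((m : ℂ) ^ 2 * z ^ 2 - (l : ℂ) ^ 2) / z ^ 2 := by field_simp; ring
    rw [e]
    generalize (m : ℂ) ^ 2 * z ^ 2 - (l : ℂ) ^ 2 = Q at hq
    field_simp
  have hsum : ∀ j ∈ Finset.range N, HasSum (fun p : ℕ+ × ℕ+ => z ^ (2 * j) *
        (1 / (p.1 : ℂ) ^ (2 * (N - j)) * (1 / (p.2 : ℂ) ^ (2 * (j + 1)))))
      (z ^ (2 * j) * (riemannZeta ((2 * (N - j) : ℕ)) * riemannZeta ((2 * (j + 1) : ℕ)))) := by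
    intro j hj
    have hj := Finset.mem_range.1 hj
    have h1 := hasSum_pnat_zeta (k := 2 * (N - j)) (by omega)
    have h2 := hasSum_pnat_zeta (k := 2 * (j + 1)) (by omega)
    have h3 := summable_mul_of_summable_norm h1.summable.norm h2.summable.norm
    exact (h1.mul h2 h3).mul_left _
  have hs := (summable_doubleTerm hN hz').hasSum
  have hs' : HasSum (fun p : ℕ+ × ℕ+ => doubleTerm N (-1 / z) p.swap)
      (∑' p, doubleTerm N (-1 / z) p) := (Equiv.prodComm ℕ+ ℕ+).hasSum_iff.2 hs
  rw [tsum_congr hterm]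
  have hs1 := (hasSum_sum hsum).neg
  have hs2 := hs'.mul_left (z ^ (2 * N) / z ^ 2)
  exact (hs1.sub hs2).tsum_eq

/-! ### Cotangent sums and Ramanujan's transformation formula -/

theorem pow_ne_one_of_norm_lt_one {x : ℂ} (hx : ‖x‖ < 1) (m : ℕ+) : 1 - x ^ (m : ℕ) ≠ 0 := by
  intro h
  have h1 : ‖x ^ (m : ℕ)‖ = 1 := by rw [← sub_eq_zero.1 h, norm_one]
  rw [norm_pow] at h1
  exact (pow_lt_one₀ (norm_nonneg x) hx m.ne_zero).ne h1

theorem summable_complexLambert (k : ℕ) {x : ℂ} (hx : ‖x‖ < 1) :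
    Summable (fun m : ℕ+ => 1 / (m : ℂ) ^ k * (x ^ (m : ℕ) / (1 - x ^ (m : ℕ)))) := by
  have hg : Summable (fun m : ℕ+ => ‖x‖ ^ (m : ℕ) * (1 - ‖x‖)⁻¹) :=
    ((summable_geometric_of_lt_one (norm_nonneg x) hx).comp_injective
      PNat.coe_injective).mul_right _
  refine Summable.of_norm_bounded hg fun m => ?_
  have h1 : (1 : ℝ) ≤ (m : ℝ) ^ k := one_le_pow₀ (by exact_mod_cast m.pos)
  have h2 : 1 - ‖x‖ ≤ ‖1 - x ^ (m : ℕ)‖ := by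
    have h3 := norm_sub_norm_le 1 (x ^ (m : ℕ))
    rw [norm_one, norm_pow] at h3
    have h4 : ‖x‖ ^ (m : ℕ) ≤ ‖x‖ := pow_le_of_le_one (norm_nonneg x) hx.le m.ne_zero
    linarith
  have h0 : 0 < 1 - ‖x‖ := sub_pos.2 hx
  rw [norm_mul, norm_div, norm_div, norm_pow, norm_pow, norm_one, Complex.norm_natCast,
    div_eq_mul_inv (‖x‖ ^ (m : ℕ))]
  calc 1 / (m : ℝ) ^ k * (‖x‖ ^ (m : ℕ) * ‖1 - x ^ (m : ℕ)‖⁻¹)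
      ≤ 1 * (‖x‖ ^ (m : ℕ) * (1 - ‖x‖)⁻¹) := by
        gcongr
        exact div_le_one_of_le₀ h1 (by positivity)
    _ = _ := one_mul _

open Complex in
theorem norm_exp_two_pi_I_mul_lt_one {z : ℂ} (hz : 0 < z.im) :
    ‖exp (2 * Real.pi * I * z)‖ < 1 :=
  UpperHalfPlane.norm_exp_two_pi_I_lt_one ⟨z, hz⟩

open Complex in
theorem pi_mul_cot_natMul {z : ℂ} (hz : 0 < z.im) (m : ℕ+) :
    Real.pi * cot (Real.pi * (m * z)) = -(2 * Real.pi * I) *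
      (1 / 2 + exp (2 * Real.pi * I * z) ^ (m : ℕ) / (1 - exp (2 * Real.pi * I * z) ^ (m : ℕ))) := by
  have h := pow_ne_one_of_norm_lt_one (norm_exp_two_pi_I_mul_lt_one hz) m
  have e : exp (2 * Real.pi * I * (m * z)) = exp (2 * Real.pi * I * z) ^ (m : ℕ) := by
    rw [← exp_nat_mul]; ring_nf
  rw [cot_pi_eq_exp_ratio, e]
  generalize exp (2 * Real.pi * I * z) ^ (m : ℕ) = y at h
  have hI := I_ne_zero
  field_simp
  rw [I_sq]
  ring

open Complex in
theorem pi_mul_cot_partialFractions {z : ℂ} (hz : 0 < z.im) (m : ℕ+) :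
    Real.pi * cot (Real.pi * (m * z)) =
      1 / (m * z) + ∑' l : ℕ+, 2 * (m * z) * (1 / ((m : ℂ) ^ 2 * z ^ 2 - (l : ℂ) ^ 2)) := by
  have hmz : 0 < ((m : ℂ) * z).im := by
    simpa using hz
  have hmem : (m : ℂ) * z ∈ integerComplement :=
    UpperHalfPlane.coe_mem_integerComplement ⟨_, hmz⟩
  rw [cot_series_rep hmem]
  congr 1
  refine tsum_congr fun l => ?_
  have h := quadratic_ne_zero hz m l
  have e : (m : ℂ) ^ 2 * z ^ 2 - (l : ℂ) ^ 2 = (m * z - l) * (m * z + l) := by ring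
  rw [e] at h ⊢
  have h1 := left_ne_zero_of_mul h
  have h2 := right_ne_zero_of_mul h
  field_simp
  ring

-- Both sides are ∑ m^{-2N-1} π cot(πmz): on the left through the exponential form of the cotangent,
-- on the right through its partial fractions.
open Complex in
theorem lambert_eq_tsum_doubleTerm {N : ℕ} (hN : 1 ≤ N) {z : ℂ} (hz : 0 < z.im) :
    -(2 * Real.pi * I) * (riemannZeta ((2 * N + 1 : ℕ)) / 2 +
      complexLambert (2 * N + 1) (exp (2 * Real.pi * I * z))) =
    riemannZeta ((2 * N + 2 : ℕ)) / z + 2 * z * ∑' p, doubleTerm N z p := by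
  have hz0 : z ≠ 0 := by rintro rfl; simp at hz
  have h1 := ((hasSum_pnat_zeta (k := 2 * N + 1) (by omega)).div_const 2).add
    (summable_complexLambert (2 * N + 1) (norm_exp_two_pi_I_mul_lt_one hz)).hasSum
  have h2 := h1.mul_left (-(2 * Real.pi * I))
  have hD := (summable_doubleTerm hN hz).hasSum.mul_left (2 * z)
  have hD' := hD.prod_fiberwise (fun m => (hD.summable.prod_factor m).hasSum)
  have h3 := ((hasSum_pnat_zeta (k := 2 * N + 2) (by omega)).div_const z).add hD'
  have hterm : ∀ m : ℕ+, -(2 * Real.pi * I) * (1 / (m : ℂ) ^ (2 * N + 1) / 2 +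
      1 / (m : ℂ) ^ (2 * N + 1) * (exp (2 * Real.pi * I * z) ^ (m : ℕ) /
        (1 - exp (2 * Real.pi * I * z) ^ (m : ℕ)))) =
      1 / (m : ℂ) ^ (2 * N + 2) / z + ∑' l : ℕ+, 2 * z * doubleTerm N z (m, l) := by
    intro m
    have hm : (m : ℂ) ≠ 0 := by simp
    have e1 : ∀ y : ℂ, -(2 * Real.pi * I) * (1 / (m : ℂ) ^ (2 * N + 1) / 2 +
        1 / (m : ℂ) ^ (2 * N + 1) * y) =
        1 / (m : ℂ) ^ (2 * N + 1) * (-(2 * Real.pi * I) * (1 / 2 + y)) := fun y => by ring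
    rw [e1, ← pi_mul_cot_natMul hz, pi_mul_cot_partialFractions hz, mul_add, ← tsum_mul_left]
    congr 1
    · field_simp
      ring
    · refine tsum_congr fun l => ?_
      rw [doubleTerm]
      generalize (m : ℂ) ^ 2 * z ^ 2 - (l : ℂ) ^ 2 = Q
      field_simp
      ring
  rw [funext hterm] at h2
  exact h2.unique h3

open Complex in
theorem lambert_transformation_zeta {N : ℕ} (hN : 1 ≤ N) {z : ℂ} (hz : 0 < z.im) :
    -(2 * Real.pi * I) * (riemannZeta ((2 * N + 1 : ℕ)) / 2 +
      complexLambert (2 * N + 1) (exp (2 * Real.pi * I * z))) =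
    z ^ (2 * N) * (-(2 * Real.pi * I) * (riemannZeta ((2 * N + 1 : ℕ)) / 2 +
      complexLambert (2 * N + 1) (exp (2 * Real.pi * I * (-1 / z))))) +
    riemannZeta ((2 * N + 2 : ℕ)) * (1 / z + z ^ (2 * N + 1)) -
      2 * ∑ j ∈ Finset.range N, z ^ (2 * j + 1) *
        (riemannZeta ((2 * (N - j) : ℕ)) * riemannZeta ((2 * (j + 1) : ℕ))) := by
  have hz0 : z ≠ 0 := by rintro rfl; simp at hz
  rw [lambert_eq_tsum_doubleTerm hN hz, lambert_eq_tsum_doubleTerm hN (neg_one_div_im_pos hz),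
    tsum_doubleTerm_reciprocity hN hz]
  have e : ∑ j ∈ Finset.range N, z ^ (2 * j + 1) *
        (riemannZeta ((2 * (N - j) : ℕ)) * riemannZeta ((2 * (j + 1) : ℕ))) =
      z * ∑ j ∈ Finset.range N, z ^ (2 * j) *
        (riemannZeta ((2 * (N - j) : ℕ)) * riemannZeta ((2 * (j + 1) : ℕ))) := by
    rw [Finset.mul_sum]
    refine Finset.sum_congr rfl fun j _ => ?_
    ring
  rw [e]
  field_simp
  ring

-- Euler's formula for ζ(2j), with the binomial coefficient supplying the factorials.
open Complex in
theorem HFun_eq_zeta (N : ℕ) (z : ℂ) :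
    -((2 * Real.pi) ^ (2 * N + 2) / (2 * ((2 * N + 2).factorial : ℂ))) * HFun N z =
    riemannZeta ((2 * N + 2 : ℕ)) * (1 / z + z ^ (2 * N + 1)) -
      2 * ∑ j ∈ Finset.range N, z ^ (2 * j + 1) *
        (riemannZeta ((2 * (N - j) : ℕ)) * riemannZeta ((2 * (j + 1) : ℕ))) := by
  have hpi : (Real.pi : ℂ) ≠ 0 := by exact_mod_cast Real.pi_ne_zero
  have key : ∀ j ∈ Finset.range (N + 2),
      -((2 * Real.pi) ^ (2 * N + 2) / (2 * ((2 * N + 2).factorial : ℂ))) * ((-1) ^ (N + 1) *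
        (z ^ (2 * (j : ℤ) - 1) * ((2 * N + 2).choose (2 * j) : ℂ) *
      ((bernoulli (2 * j) : ℚ) : ℂ) * ((bernoulli (2 * N + 2 - 2 * j) : ℚ) : ℂ))) =
      -2 * (z ^ (2 * (j : ℤ) - 1) * (riemannZeta ((2 * j : ℕ)) *
        riemannZeta ((2 * (N + 1 - j) : ℕ)))) := by
    intro j hj
    obtain ⟨i, hi⟩ : ∃ i, N + 1 = i + j := ⟨N + 1 - j, by have := Finset.mem_range.1 hj; omega⟩
    have e1 : N + 1 - j = i := by omega
    have e2 : 2 * N + 2 - 2 * j = 2 * i := by omega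
    have e3 : 2 * N + 2 = 2 * j + 2 * i := by omega
    have hc : (((2 * N + 2).choose (2 * j) : ℕ) : ℂ) =
        ((2 * N + 2).factorial : ℂ) / ((2 * j).factorial * (2 * i).factorial) := by
      rw [e3, Nat.cast_add_choose]
    have f1 : ((2 * N + 2).factorial : ℂ) ≠ 0 := by exact_mod_cast Nat.factorial_ne_zero _
    have f2 : ((2 * j).factorial : ℂ) ≠ 0 := by exact_mod_cast Nat.factorial_ne_zero _
    have f3 : ((2 * i).factorial : ℂ) ≠ 0 := by exact_mod_cast Nat.factorial_ne_zero _
    rw [hc, e1, e2, Nat.cast_mul, Nat.cast_mul, Nat.cast_two, riemannZeta_two_mul_nat',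
      riemannZeta_two_mul_nat', hi, e3, zpow_sub_one₀ two_ne_zero, zpow_sub_one₀ two_ne_zero]
    generalize z ^ (2 * (j : ℤ) - 1) = Z
    have g1 : (2 : ℂ) ^ (2 * (j : ℤ)) = 2 ^ (2 * j) := by norm_cast
    have g2 : (2 : ℂ) ^ (2 * (i : ℤ)) = 2 ^ (2 * i) := by norm_cast
    rw [g1, g2]
    rw [e3] at f1
    simp only [pow_add, mul_pow]
    field_simp
  -- Euler's formula also holds at j = 0, so the two end terms of H_N are ζ(0)ζ(2N+2); the factor -2
  -- · (-1/2) = 1 explains why they lack the 2 of the inner sum.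
  have z0 : riemannZeta ((2 * 0 : ℕ)) = -1 / 2 := by simp [riemannZeta_zero]
  rw [HFun, Finset.mul_sum, Finset.mul_sum, Finset.sum_congr rfl key,
    Finset.sum_range_succ, Finset.sum_range_succ']
  rw [show N + 1 - (N + 1) = 0 by omega, z0]
  have e4 : ∀ j ∈ Finset.range N, -2 * (z ^ (2 * ((j + 1 : ℕ) : ℤ) - 1) *
      (riemannZeta ((2 * (j + 1) : ℕ)) * riemannZeta ((2 * (N + 1 - (j + 1)) : ℕ)))) =
      -2 * (z ^ (2 * j + 1) *
        (riemannZeta ((2 * (N - j) : ℕ)) * riemannZeta ((2 * (j + 1) : ℕ)))) := by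
    intro j _
    have : z ^ (2 * ((j + 1 : ℕ) : ℤ) - 1) = z ^ (2 * j + 1) := by
      rw [← zpow_natCast]; congr 1; push_cast; ring
    rw [this, Nat.add_sub_add_right]
    ring
  rw [Finset.sum_congr rfl e4, ← Finset.mul_sum]
  have e5 : z ^ (2 * ((N + 1 : ℕ) : ℤ) - 1) = z ^ (2 * N + 1) := by
    rw [← zpow_natCast]; congr 1; push_cast; ring
  have e6 : z ^ (2 * ((0 : ℕ) : ℤ) - 1) = 1 / z := by simp
  rw [e5, e6, show 2 * (N + 1 - 0) = 2 * N + 2 by omega, show 2 * (N + 1) = 2 * N + 2 by omega]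
  ring

open Complex in
theorem lambert_transformation {N : ℕ} (hN : 1 ≤ N) {z : ℂ} (hz : 0 < z.im) :
    riemannZeta ((2 * N + 1 : ℕ)) / 2 +
      complexLambert (2 * N + 1) (exp (2 * Real.pi * I * z)) =
    z ^ (2 * N) * (riemannZeta ((2 * N + 1 : ℕ)) / 2 +
      complexLambert (2 * N + 1) (exp (2 * Real.pi * I * (-1 / z)))) -
    I * ((2 * Real.pi) ^ (2 * N + 1) / (2 * ((2 * N + 2).factorial : ℂ))) * HFun N z := by
  have hz0 : z ≠ 0 := by rintro rfl; simp at hz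
  have hpi : (Real.pi : ℂ) ≠ 0 := by exact_mod_cast Real.pi_ne_zero
  have h := lambert_transformation_zeta hN hz
  rw [add_sub_assoc, ← HFun_eq_zeta N z] at h
  have hc : -(2 * Real.pi * I) ≠ 0 := by simp [hpi]
  apply mul_left_cancel₀ hc
  rw [h]
  have : (2 * (Real.pi : ℂ)) ^ (2 * N + 2) = (2 * Real.pi) ^ (2 * N + 1) * (2 * Real.pi) :=
    pow_succ _ _
  rw [this]
  ring_nf
  rw [I_sq]
  ring

/-! ### Sums over roots of unity -/

theorem hasSum_complexLambert (k : ℕ) {x : ℂ} (hx : ‖x‖ < 1) :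
    HasSum (fun m : ℕ+ => 1 / (m : ℂ) ^ k * (x ^ (m : ℕ) / (1 - x ^ (m : ℕ))))
      (complexLambert k x) :=
  (summable_complexLambert k hx).hasSum

/-- `T m` stands for the sum of (ζx)^m/(1-(ζx)^m) over the p-th roots of unity ζ. For p prime,
either ζ^m runs through all the roots or every ζ^m is 1, which gives the two hypotheses. Using the
first value for all m yields p·S(x^p); the correction `g` lives on multiples of p and reindexes to
S(x^p) - S(x^{p²}). -/
theorem hasSum_hecke (k : ℕ) (p : ℕ+) {x : ℂ} (hx : ‖x‖ < 1) (T : ℕ+ → ℂ)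
    (h1 : ∀ m : ℕ+, ¬ (p : ℕ) ∣ m →
      T m = p * ((x ^ (p : ℕ)) ^ (m : ℕ) / (1 - (x ^ (p : ℕ)) ^ (m : ℕ))))
    (h2 : ∀ m : ℕ+, (p : ℕ) ∣ m → T m = p * (x ^ (m : ℕ) / (1 - x ^ (m : ℕ)))) :
    HasSum (fun m : ℕ+ => 1 / (m : ℂ) ^ k * T m)
      ((p + p / (p : ℂ) ^ k) * complexLambert k (x ^ (p : ℕ)) -
        p / (p : ℂ) ^ k * complexLambert k ((x ^ (p : ℕ)) ^ (p : ℕ))) := by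
  have hxp : ‖x ^ (p : ℕ)‖ < 1 := by
    rw [norm_pow]; exact pow_lt_one₀ (norm_nonneg _) hx p.ne_zero
  have hxpp : ‖(x ^ (p : ℕ)) ^ (p : ℕ)‖ < 1 := by
    rw [norm_pow]; exact pow_lt_one₀ (norm_nonneg _) hxp p.ne_zero
  let g : ℕ+ → ℂ := fun m => if (p : ℕ) ∣ m then
    1 / (m : ℂ) ^ k * (p * (x ^ (m : ℕ) / (1 - x ^ (m : ℕ)) -
      (x ^ (p : ℕ)) ^ (m : ℕ) / (1 - (x ^ (p : ℕ)) ^ (m : ℕ)))) else 0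
  have hinj : Function.Injective (fun m : ℕ+ => p * m) := mul_right_injective p
  have hg : HasSum g (p / (p : ℂ) ^ k * (complexLambert k (x ^ (p : ℕ)) -
      complexLambert k ((x ^ (p : ℕ)) ^ (p : ℕ)))) := by
    refine (hinj.hasSum_iff (fun m hm => ?_)).1 ?_
    · refine if_neg fun hd => hm ?_
      obtain ⟨c, hc⟩ := PNat.dvd_iff.2 hd
      exact ⟨c, hc.symm⟩
    · have h := ((hasSum_complexLambert k hxp).sub (hasSum_complexLambert k hxpp)).mul_left
        (p / (p : ℂ) ^ k)
      refine h.congr_fun ?_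
      intro m
      simp only [g, Function.comp, PNat.mul_coe, dvd_mul_right, if_true, Nat.cast_mul, mul_pow,
        ← pow_mul, mul_assoc]
      generalize x ^ ((p : ℕ) * (m : ℕ)) / _ = A
      generalize x ^ ((p : ℕ) * ((p : ℕ) * (m : ℕ))) / _ = B
      simp only [div_eq_mul_inv, mul_inv]
      ring
  have h := ((hasSum_complexLambert k hxp).mul_left (p : ℂ)).add hg
  have e : ∀ P Q A B : ℂ, (P + Q) * A - Q * B = P * A + Q * (A - B) := fun P Q A B => by ring
  rw [e]
  refine h.congr_fun ?_
  intro m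
  by_cases hd : (p : ℕ) ∣ m
  · simp only [g, if_pos hd, h2 m hd]; ring
  · simp only [g, if_neg hd, h1 m hd]; ring

theorem complexLambert_add_neg (k : ℕ) {x : ℂ} (hx : ‖x‖ < 1) :
    complexLambert k x + complexLambert k (-x) =
      (2 + 2 / 2 ^ k) * complexLambert k (x ^ 2) - 2 / 2 ^ k * complexLambert k (x ^ 4) := by
  have hx' : ‖-x‖ < 1 := by rwa [norm_neg]
  have h := (hasSum_complexLambert k hx).add (hasSum_complexLambert k hx')
  simp only [← mul_add] at h
  have h2 := hasSum_hecke k 2 hx _ (fun m hm => ?_) (fun m hm => ?_) |>.unique h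
  · rw [← h2, show (4 : ℕ) = 2 * 2 from rfl, pow_mul]
    norm_num
  · have hodd : Odd (m : ℕ) := Nat.not_even_iff_odd.1 fun he => hm he.two_dvd
    have n1 := pow_ne_one_of_norm_lt_one hx m
    have n2 := pow_ne_one_of_norm_lt_one hx' m
    rw [hodd.neg_pow] at n2 ⊢
    rw [pow_right_comm]
    generalize x ^ (m : ℕ) = y at *
    have n3 : 1 - y ^ 2 ≠ 0 := by
      rw [show 1 - y ^ 2 = (1 - y) * (1 - -y) by ring]; exact mul_ne_zero n1 n2
    simp only [PNat.val_ofNat, Nat.cast_ofNat]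
    field_simp
    ring
  · have heven : Even (m : ℕ) := (even_iff_two_dvd).2 hm
    rw [heven.neg_pow]
    simp only [PNat.val_ofNat, Nat.cast_ofNat]
    ring

theorem complexLambert_add_cubeRoots (k : ℕ) {x ω : ℂ} (hx : ‖x‖ < 1) (hω : ‖ω‖ = 1)
    (h3 : ω ^ 2 + ω + 1 = 0) :
    complexLambert k x + complexLambert k (ω * x) + complexLambert k (ω ^ 2 * x) =
      (3 + 3 / 3 ^ k) * complexLambert k (x ^ 3) - 3 / 3 ^ k * complexLambert k (x ^ 9) := by
  have hx1 : ‖ω * x‖ < 1 := by simpa [hω] using hx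
  have hx2 : ‖ω ^ 2 * x‖ < 1 := by simpa [hω] using hx
  have hω3 : ω ^ 3 = 1 := by linear_combination (ω - 1) * h3
  have h := ((hasSum_complexLambert k hx).add (hasSum_complexLambert k hx1)).add
    (hasSum_complexLambert k hx2)
  simp only [← mul_add] at h
  have key : ∀ y ν : ℂ, 1 - y ≠ 0 → 1 - ν * y ≠ 0 → 1 - ν ^ 2 * y ≠ 0 → ν ^ 2 + ν + 1 = 0 →
      y / (1 - y) + ν * y / (1 - ν * y) + ν ^ 2 * y / (1 - ν ^ 2 * y) =
        3 * (y ^ 3 / (1 - y ^ 3)) := by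
    intro y ν n1 n2 n3 hν
    have hp : (1 - y) * (1 - ν * y) * (1 - ν ^ 2 * y) = 1 - y ^ 3 := by
      linear_combination (-y + ν * y ^ 2 - (ν - 1) * y ^ 3) * hν
    have n4 : 1 - y ^ 3 ≠ 0 := by
      rw [← hp]; exact mul_ne_zero (mul_ne_zero n1 n2) n3
    rw [div_add_div _ _ n1 n2, div_add_div _ _ (mul_ne_zero n1 n2) n3, hp, ← mul_div_assoc]
    congr 1
    linear_combination (y - 2 * ν * y ^ 2 + 3 * (ν - 1) * y ^ 3) * hν
  have h2 := hasSum_hecke k 3 hx _ (fun m hm => ?_) (fun m hm => ?_) |>.unique h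
  · rw [← h2, show (9 : ℕ) = 3 * 3 from rfl, pow_mul]
    norm_num
  · have n1 := pow_ne_one_of_norm_lt_one hx m
    have n2 := pow_ne_one_of_norm_lt_one hx1 m
    have n3 := pow_ne_one_of_norm_lt_one hx2 m
    have hν : (ω ^ (m : ℕ)) ^ 2 + ω ^ (m : ℕ) + 1 = 0 := by
      have hm' : ¬ 3 ∣ (m : ℕ) := hm
      rw [← Nat.div_add_mod (m : ℕ) 3, pow_add, pow_mul, hω3, one_pow, one_mul]
      have : (m : ℕ) % 3 = 1 ∨ (m : ℕ) % 3 = 2 := by omega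
      rcases this with h | h <;> rw [h]
      · linear_combination h3
      · linear_combination h3 + ω * hω3
    rw [mul_pow] at n2
    rw [mul_pow, pow_right_comm] at n3
    rw [mul_pow, mul_pow, pow_right_comm ω 2, key _ _ n1 n2 n3 hν, pow_right_comm]
    norm_num
  · obtain ⟨c, hc⟩ := hm
    have hc : (m : ℕ) = 3 * c := hc
    have e : ω ^ (m : ℕ) = 1 := by rw [hc, pow_mul, hω3, one_pow]
    rw [mul_pow, mul_pow, pow_right_comm ω 2, e]
    simp only [PNat.val_ofNat, Nat.cast_ofNat]
    ring

/-! ### Real arguments; symmetry and rationality of H -/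

theorem complexLambert_ofReal (k : ℕ) (x : ℝ) : complexLambert k x = lambertS k x := by
  rw [complexLambert, lambertS, Complex.ofReal_tsum]
  refine (tsum_pnat_eq_tsum_succ
    (f := fun m : ℕ => 1 / (m : ℂ) ^ k * ((x : ℂ) ^ m / (1 - (x : ℂ) ^ m)))).trans ?_
  refine tsum_congr fun m => ?_
  simp only [lambertTerm]
  push_cast
  ring

theorem summable_lambertTerm (k : ℕ) {x : ℝ} (h0 : 0 ≤ x) (h1 : x < 1) :
    Summable (fun m : ℕ => lambertTerm k x (m + 1)) := by
  have h := summable_complexLambert k (x := (x : ℂ)) (by rwa [Complex.norm_real, Real.norm_of_nonneg h0])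
  have h2 := (Equiv.pnatEquivNat.symm.summable_iff).2 h
  rw [← Complex.summable_ofReal]
  refine h2.congr fun m => ?_
  simp [lambertTerm, Function.comp]

/-- H has rational coefficients and only odd powers of z. -/
theorem HFun_neg_conj (N : ℕ) (z : ℂ) :
    HFun N (-(starRingEnd ℂ) z) = -(starRingEnd ℂ) (HFun N z) := by
  simp only [HFun, map_mul, map_sum, map_pow, map_neg, map_one, map_zpow₀, map_natCast,
    map_ratCast]
  rw [← mul_neg, ← Finset.sum_neg_distrib]
  congr 1
  refine Finset.sum_congr rfl fun j _ => ?_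
  have hodd : Odd (2 * (j : ℤ) - 1) := ⟨j - 1, by ring⟩
  rw [hodd.neg_zpow]
  ring

/-- The field of Gaussian rationals inside `ℂ`. -/
def gaussianRationals : Subfield ℂ where
  carrier := {w | ∃ a b : ℚ, w = a + b * Complex.I}
  mul_mem' := by
    rintro _ _ ⟨a, b, rfl⟩ ⟨c, d, rfl⟩
    refine ⟨a * c - b * d, a * d + b * c, ?_⟩
    push_cast
    linear_combination (b * d : ℂ) * Complex.I_sq
  one_mem' := ⟨1, 0, by simp⟩
  add_mem' := by
    rintro _ _ ⟨a, b, rfl⟩ ⟨c, d, rfl⟩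
    exact ⟨a + c, b + d, by push_cast; ring⟩
  zero_mem' := ⟨0, 0, by simp⟩
  neg_mem' := by
    rintro _ ⟨a, b, rfl⟩
    exact ⟨-a, -b, by push_cast; ring⟩
  inv_mem' := by
    rintro _ ⟨a, b, rfl⟩
    refine ⟨a / (a * a + b * b), -b / (a * a + b * b), ?_⟩
    rw [Complex.inv_def, Complex.normSq_apply]
    simp
    ring

theorem HFun_mem_gaussianRationals (N : ℕ) {z : ℂ} (hz : z ∈ gaussianRationals) :
    HFun N z ∈ gaussianRationals := by
  refine mul_mem (pow_mem (neg_mem (one_mem _)) _) (sum_mem fun j _ => ?_)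
  exact mul_mem (mul_mem (mul_mem (zpow_mem hz _) (natCast_mem _ _)) (SubfieldClass.ratCast_mem _ _))
    (SubfieldClass.ratCast_mem _ _)

theorem exists_rat_im_eq {w : ℂ} (hw : w ∈ gaussianRationals) : ∃ r : ℚ, w.im = r := by
  obtain ⟨a, b, rfl⟩ := hw
  exact ⟨b, by simp⟩

theorem I_mem_gaussianRationals : Complex.I ∈ gaussianRationals := ⟨0, 1, by simp⟩

theorem exists_rat_HFun_im (N : ℕ) :
    ∃ r : ℚ, (2 * HFun N ((2 + 2 * Complex.I) / 3) + HFun N (2 * Complex.I / 3)).im = r := by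
  have h2 : (2 : ℂ) ∈ gaussianRationals := ofNat_mem _ 2
  have h3 : (3 : ℂ) ∈ gaussianRationals := ofNat_mem _ 3
  have h2I := mul_mem h2 I_mem_gaussianRationals
  exact exists_rat_im_eq (add_mem (mul_mem h2 (HFun_mem_gaussianRationals N
    (div_mem (add_mem h2 h2I) h3))) (HFun_mem_gaussianRationals N (div_mem h2I h3)))

theorem HFun_sum_conjugates (N : ℕ) :
    HFun N (2 * Complex.I / 3) + HFun N ((2 + 2 * Complex.I) / 3) +
      HFun N ((-2 + 2 * Complex.I) / 3) =
    Complex.I * ((2 * HFun N ((2 + 2 * Complex.I) / 3) + HFun N (2 * Complex.I / 3)).im : ℝ) := by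
  have h1 := HFun_neg_conj N (2 * Complex.I / 3)
  have h2 := HFun_neg_conj N ((2 + 2 * Complex.I) / 3)
  have e1 : -(starRingEnd ℂ) (2 * Complex.I / 3) = 2 * Complex.I / 3 := by
    simp [Complex.conj_ofNat]; ring
  have e2 : -(starRingEnd ℂ) ((2 + 2 * Complex.I) / 3) = (-2 + 2 * Complex.I) / 3 := by
    simp [Complex.conj_ofNat]; ring
  rw [e1] at h1
  rw [e2] at h2
  rw [h2]
  generalize HFun N (2 * Complex.I / 3) = A at *
  generalize HFun N ((2 + 2 * Complex.I) / 3) = B at *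
  have hA : A.re = 0 := by
    have := congrArg Complex.re h1
    simp at this
    linarith
  apply Complex.ext
  · simp [hA]
  · simp; ring

/-! ### The linear relation between ζ(4n+1) and the four Lambert series -/

theorem qOne_pos : 0 < qOne := Real.exp_pos _

theorem qOne_lt_one : qOne < 1 := Real.exp_lt_one_iff.2 (neg_lt_zero.2 Real.pi_pos)

theorem norm_qOne_pow_lt_one {d : ℕ} (hd : d ≠ 0) : ‖(qOne : ℂ) ^ d‖ < 1 := by
  rw [norm_pow, Complex.norm_real, Real.norm_of_nonneg qOne_pos.le]
  exact pow_lt_one₀ qOne_pos.le qOne_lt_one hd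

open Complex in
theorem qOne_pow (d : ℕ) : (qOne : ℂ) ^ d = exp (-(d * Real.pi)) := by
  rw [qOne, ofReal_exp, ← exp_nat_mul]
  push_cast
  ring_nf

open Complex in
theorem lambert_relation {n : ℕ} (hn : 1 ≤ n) :
    3 / 2 * riemannZeta ((4 * n + 1 : ℕ)) +
      (3 + 3 / 3 ^ (4 * n + 1)) * complexLambert (4 * n + 1) ((qOne : ℂ) ^ 4) -
      3 / 3 ^ (4 * n + 1) * complexLambert (4 * n + 1) ((qOne : ℂ) ^ 12) =
    (16 / 81) ^ n * (riemannZeta ((4 * n + 1 : ℕ)) / 2 +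
      complexLambert (4 * n + 1) ((qOne : ℂ) ^ 3)) +
    (-64 / 81) ^ n * (riemannZeta ((4 * n + 1 : ℕ)) +
      ((2 + 2 / 2 ^ (4 * n + 1)) * (-complexLambert (4 * n + 1) ((qOne : ℂ) ^ 3) +
        (2 + 2 / 2 ^ (4 * n + 1)) * complexLambert (4 * n + 1) ((qOne : ℂ) ^ 6) -
        2 / 2 ^ (4 * n + 1) * complexLambert (4 * n + 1) ((qOne : ℂ) ^ 12)) -
      2 / 2 ^ (4 * n + 1) * complexLambert (4 * n + 1) ((qOne : ℂ) ^ 6))) +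
    (2 * Real.pi) ^ (4 * n + 1) / (2 * ((4 * n + 2).factorial : ℂ)) *
      ((2 * HFun (2 * n) ((2 + 2 * I) / 3) + HFun (2 * n) (2 * I / 3)).im : ℝ) := by
  have hN : 1 ≤ 2 * n := by omega
  have t1 := lambert_transformation hN (z := 2 * I / 3) (by norm_num)
  have t2 := lambert_transformation hN (z := (2 + 2 * I) / 3) (by norm_num)
  have t3 := lambert_transformation hN (z := (-2 + 2 * I) / 3) (by norm_num)
  have hH := HFun_sum_conjugates (2 * n)
  simp only [show 2 * (2 * n) = 4 * n by ring] at t1 t2 t3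
  set ω : ℂ := exp (2 * Real.pi * I / 3) with hω
  set r : ℂ := exp (-(4 * Real.pi / 3)) with hr
  set s : ℂ := exp (-(3 * Real.pi / 2)) with hs
  have hprim : IsPrimitiveRoot ω 3 := by simpa using isPrimitiveRoot_exp 3 (by norm_num)
  have hω3 : ω ^ 3 = 1 := hprim.pow_eq_one
  have hωsum : ω ^ 2 + ω + 1 = 0 := by
    have := hprim.geom_sum_eq_zero (by norm_num)
    simp [Finset.sum_range_succ] at this
    linear_combination this
  have hωn : ‖ω‖ = 1 := hprim.norm'_eq_one (by norm_num)
  -- Here r and s are the moduli of the nomes: r belongs to the three points z, and s to the images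
  -- -1/z of the two points off the imaginary axis.
  have norm_exp_lt : ∀ t : ℝ, 0 < t → ‖exp (-(t : ℂ))‖ < 1 := by
    intro t ht
    rw [← ofReal_neg, norm_exp_ofReal]
    exact Real.exp_lt_one_iff.2 (neg_lt_zero.2 ht)
  have hrn : ‖r‖ < 1 := by
    have := norm_exp_lt (4 * Real.pi / 3) (by positivity)
    push_cast at this
    exact this
  have hsn : ‖s‖ < 1 := by
    have := norm_exp_lt (3 * Real.pi / 2) (by positivity)
    push_cast at this
    exact this
  have hr3 : r ^ 3 = (qOne : ℂ) ^ 4 := by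
    rw [qOne_pow, hr, ← exp_nat_mul]; congr 1; push_cast; ring
  have hr9 : r ^ 9 = (qOne : ℂ) ^ 12 := by
    rw [qOne_pow, hr, ← exp_nat_mul]; congr 1; push_cast; ring
  have hs2 : s ^ 2 = (qOne : ℂ) ^ 3 := by
    rw [qOne_pow, hs, ← exp_nat_mul]; congr 1; push_cast; ring
  have hs4 : s ^ 4 = (qOne : ℂ) ^ 6 := by
    rw [qOne_pow, hs, ← exp_nat_mul]; congr 1; push_cast; ring
  have a1 : exp (2 * Real.pi * I * (2 * I / 3)) = r := by
    rw [hr]; congr 1; linear_combination (4 * Real.pi / 3) * I_sq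
  have a2 : exp (2 * Real.pi * I * ((2 + 2 * I) / 3)) = ω ^ 2 * r := by
    rw [hr, hω, ← exp_nat_mul, ← exp_add]
    congr 1; push_cast; linear_combination (4 * Real.pi / 3) * I_sq
  have a3 : exp (2 * Real.pi * I * ((-2 + 2 * I) / 3)) = ω * r := by
    have : ω = exp (-(4 * Real.pi * I / 3)) := by
      rw [hω, ← exp_periodic (-(4 * Real.pi * I / 3))]; congr 1; ring
    rw [this, hr, ← exp_add]
    congr 1; linear_combination (4 * Real.pi / 3) * I_sq
  have b1 : exp (2 * Real.pi * I * (-1 / (2 * I / 3))) = (qOne : ℂ) ^ 3 := by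
    have : -1 / (2 * I / 3) = 3 * I / 2 := by
      have := I_ne_zero
      field_simp
      rw [I_sq]
    rw [this, qOne_pow]; congr 1; push_cast; linear_combination (3 * Real.pi) * I_sq
  have ne2 : (2 + 2 * I) / 3 ≠ 0 := fun h => by simpa using congrArg im h
  have ne3 : (-2 + 2 * I) / 3 ≠ 0 := fun h => by simpa using congrArg im h
  have hIs : I * s = exp (Real.pi / 2 * I + -(3 * Real.pi / 2)) := by
    rw [exp_add, exp_pi_div_two_mul_I]
  have b2 : exp (2 * Real.pi * I * (-1 / ((2 + 2 * I) / 3))) = I * s := by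
    have : -1 / ((2 + 2 * I) / 3) = (-3 + 3 * I) / 4 := by
      rw [div_eq_iff ne2]; linear_combination (-1 / 2) * I_sq
    -- The exponent here has imaginary part -3π/2; adding the period 2πi gives the π/2 of `hIs`.
    rw [this, hIs, ← exp_periodic]
    congr 1; linear_combination (3 * Real.pi / 2) * I_sq
  have b3 : exp (2 * Real.pi * I * (-1 / ((-2 + 2 * I) / 3))) = -(I * s) := by
    have : -1 / ((-2 + 2 * I) / 3) = (3 + 3 * I) / 4 := by
      rw [div_eq_iff ne3]; linear_combination (-1 / 2) * I_sq
    rw [this, hIs, ← neg_one_mul, ← exp_pi_mul_I, ← exp_add]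
    congr 1; linear_combination (3 * Real.pi / 2) * I_sq
  have z1 : (2 * I / 3) ^ (4 * n) = (16 / 81) ^ n := by
    rw [pow_mul, div_pow, mul_pow, I_pow_four]; norm_num
  have z2 : ((2 + 2 * I) / 3) ^ (4 * n) = (-64 / 81) ^ n := by
    rw [pow_mul]; congr 1
    linear_combination (16 / 81 * (I ^ 2 + 4 * I + 5)) * I_sq
  have z3 : ((-2 + 2 * I) / 3) ^ (4 * n) = (-64 / 81) ^ n := by
    rw [pow_mul]; congr 1
    linear_combination (16 / 81 * (I ^ 2 - 4 * I + 5)) * I_sq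
  rw [a1, b1, z1] at t1
  rw [a2, b2, z2] at t2
  rw [a3, b3, z3] at t3
  have T3 := complexLambert_add_cubeRoots (4 * n + 1) hrn hωn hωsum
  rw [hr3, hr9] at T3
  -- With x = is the squares are x² = -q₁³ and x⁴ = q₁⁶. The negative nome -q₁³ is removed by `T2'`,
  -- the same relation at x = q₁³.
  have T2 := complexLambert_add_neg (4 * n + 1) (x := I * s) (by simpa using hsn)
  rw [mul_pow, mul_pow, I_sq, I_pow_four, one_mul, neg_one_mul, hs2, hs4] at T2
  have T2' := complexLambert_add_neg (4 * n + 1) (norm_qOne_pow_lt_one (d := 3) (by norm_num))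
  rw [← pow_mul, ← pow_mul] at T2'
  norm_num at T2'
  linear_combination t1 + t2 + t3 - T3 + (-64 / 81) ^ n * T2 +
    (-64 / 81) ^ n * (2 + 2 / 2 ^ (4 * n + 1)) * T2' -
    I * ((2 * Real.pi) ^ (4 * n + 1) / (2 * ((4 * n + 2).factorial : ℂ))) * hH -
    ((2 * Real.pi) ^ (4 * n + 1) / (2 * ((4 * n + 2).factorial : ℂ))) *
      ((2 * HFun (2 * n) ((2 + 2 * I) / 3) + HFun (2 * n) (2 * I / 3)).im : ℝ) * I_sq

/-! ### Merit -/

open Filter in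
-- If u_m ~ c x^m/m^k with c ≠ 0, the polynomial factor drops out of the ratio. A vanishing u_m is
-- harmless, since both quotients then take the default value 0.
theorem tendsto_ratio_of_normalized {u : ℕ → ℝ} {x c : ℝ} (k : ℕ) (hx : 0 < x) (hc : c ≠ 0)
    (h : Tendsto (fun m : ℕ => u m * ((m : ℝ) ^ k / x ^ m)) atTop (nhds c)) :
    Tendsto (fun m => u (m + 1) / u m) atTop (nhds x) := by
  have h1 := (h.comp (tendsto_add_atTop_nat 1)).div h hc
  have h2 : Tendsto (fun m : ℕ => (m : ℝ) / (m + 1)) atTop (nhds 1) :=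
    tendsto_natCast_div_add_atTop (1 : ℝ)
  have h3 := h1.mul ((h2.pow k).mul_const x)
  rw [div_self hc, one_pow, one_mul, one_mul] at h3
  refine h3.congr' ?_
  filter_upwards [eventually_gt_atTop 0] with m hm
  have hm' : (m : ℝ) ≠ 0 := by exact_mod_cast hm.ne'
  have hm1 : (m : ℝ) + 1 ≠ 0 := by positivity
  have hx' := hx.ne'
  simp only [Pi.div_apply, Function.comp]
  rcases eq_or_ne (u m) 0 with h0 | h0
  · simp [h0]
  · have hmk := pow_ne_zero k hm1
    push_cast
    rw [div_pow, pow_succ]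
    generalize ((m : ℝ) + 1) ^ k = A at *
    field_simp

theorem lambertTerm_normalized (k : ℕ) {x : ℝ} (y : ℝ) (hx : x ≠ 0) {m : ℕ} (hm : 0 < m) :
    lambertTerm k y m * ((m : ℝ) ^ k / x ^ m) = (y / x) ^ m * (1 / (1 - y ^ m)) := by
  have hm' : (m : ℝ) ≠ 0 := by exact_mod_cast hm.ne'
  rw [lambertTerm, div_pow]
  field_simp

open Filter in
theorem tendsto_lambertTerm_self (k : ℕ) {x : ℝ} (hx : 0 < x) (h1 : x < 1) :
    Tendsto (fun m : ℕ => lambertTerm k x m * ((m : ℝ) ^ k / x ^ m)) atTop (nhds 1) := by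
  have h := (tendsto_pow_atTop_nhds_zero_of_lt_one hx.le h1).const_sub 1 |>.inv₀ (by norm_num)
  rw [sub_zero, inv_one] at h
  refine h.congr' ?_
  filter_upwards [eventually_gt_atTop 0] with m hm
  rw [lambertTerm_normalized k x hx.ne' hm, div_self hx.ne', one_pow, one_mul, one_div]

open Filter in
theorem tendsto_lambertTerm_of_lt (k : ℕ) {x y : ℝ} (hy : 0 < y) (hyx : y < x) (h1 : x < 1) :
    Tendsto (fun m : ℕ => lambertTerm k y m * ((m : ℝ) ^ k / x ^ m)) atTop (nhds 0) := by
  have hx : 0 < x := hy.trans hyx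
  have h := (tendsto_pow_atTop_nhds_zero_of_lt_one hy.le (hyx.trans h1)).const_sub 1 |>.inv₀
    (by norm_num)
  have h2 := (tendsto_pow_atTop_nhds_zero_of_lt_one (div_nonneg hy.le hx.le)
    ((div_lt_one hx).2 hyx)).mul h
  rw [zero_mul] at h2
  refine h2.congr' ?_
  filter_upwards [eventually_gt_atTop 0] with m hm
  rw [lambertTerm_normalized k y hx.ne' hm, one_div]

theorem exp_neg_pi_mul_natCast (d : ℕ) : Real.exp (-(Real.pi * d)) = qOne ^ d := by
  rw [qOne, ← Real.exp_nat_mul]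
  ring_nf

theorem hasMerit_lambertTerm (k : ℕ) {d : ℕ} (hd : d ≠ 0) :
    HasMerit (lambertTerm k (qOne ^ d)) ((d : ℝ) ^ 2) := by
  rw [HasMerit, Real.sqrt_sq (Nat.cast_nonneg d), exp_neg_pi_mul_natCast]
  exact tendsto_ratio_of_normalized k (pow_pos qOne_pos d) one_ne_zero
    (tendsto_lambertTerm_self k (pow_pos qOne_pos d) (pow_lt_one₀ qOne_pos.le qOne_lt_one hd))

theorem hasMerit_nine_combination (k : ℕ) {C : ℕ → ℝ} (hC : C 3 ≠ 0) :
    HasMerit (fun m : ℕ => ∑ d ∈ ({3, 4, 6, 12} : Finset ℕ),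
      C d * lambertTerm k (qOne ^ d) m) 9 := by
  rw [HasMerit, show (9 : ℝ) = ((3 : ℕ) : ℝ) ^ 2 by norm_num, Real.sqrt_sq (Nat.cast_nonneg 3),
    exp_neg_pi_mul_natCast]
  have hlt : qOne ^ 3 < 1 := pow_lt_one₀ qOne_pos.le qOne_lt_one (by norm_num)
  refine tendsto_ratio_of_normalized (u := fun m => ∑ d ∈ ({3, 4, 6, 12} : Finset ℕ),
    C d * lambertTerm k (qOne ^ d) m) k (pow_pos qOne_pos 3) hC ?_
  have hd : ∀ d, 3 < d → Filter.Tendsto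
      (fun m : ℕ => C d * (lambertTerm k (qOne ^ d) m * ((m : ℝ) ^ k / (qOne ^ 3) ^ m)))
      Filter.atTop (nhds 0) := by
    intro d hd
    have := (tendsto_lambertTerm_of_lt k (pow_pos qOne_pos d)
      (pow_lt_pow_right_of_lt_one₀ qOne_pos qOne_lt_one hd) hlt).const_mul (C d)
    rwa [mul_zero] at this
  have h := ((tendsto_lambertTerm_self k (pow_pos qOne_pos 3) hlt).const_mul (C 3)).add
    ((hd 4 (by norm_num)).add ((hd 6 (by norm_num)).add (hd 12 (by norm_num))))
  rw [add_zero, add_zero, add_zero, mul_one] at h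
  refine h.congr fun m => ?_
  simp
  ring

/-! ### The coefficients and the final assembly -/

theorem cSeq_ne_zero {n : ℕ} (hn : 1 ≤ n) : cSeq n ≠ 0 := by
  -- A power of 3 minus even numbers; 2^{4n} is even because n ≥ 1.
  have hodd : Odd (cSeq n) := by
    have h2 : Even ((2 : ℤ) ^ (4 * n)) := (even_two).pow_of_ne_zero (by omega)
    exact ((Odd.pow (by decide)).sub_even (even_two_mul _)).sub_even h2
  exact fun h => by simp [h] at hodd

theorem cSeq_cast (K : Type*) [Field K] (n : ℕ) :
    ((cSeq n : ℤ) : K) = 3 * 81 ^ n - 2 * ((-4) ^ n * 16 ^ n) - 16 ^ n := by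
  simp only [cSeq, pow_succ, pow_mul, ← mul_pow]
  push_cast
  norm_num [mul_comm]

/-- The coefficient of `S_{4n+1}(exp (-3π))`. -/
def coeffThree (n : ℕ) : ℚ := 2 / (cSeq n : ℚ) * (16 ^ n - (-4) ^ n * (2 * 16 ^ n + 1))

theorem coeffThree_ne_zero {n : ℕ} (hn : 1 ≤ n) : coeffThree n ≠ 0 := by
  have hc : (cSeq n : ℚ) ≠ 0 := by exact_mod_cast cSeq_ne_zero hn
  refine mul_ne_zero (div_ne_zero two_ne_zero hc) fun h => ?_
  have h1 : ((16 : ℤ) ^ n) = (-4) ^ n * (2 * 16 ^ n + 1) := by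
    have h2 : (16 : ℚ) ^ n = (-4) ^ n * (2 * 16 ^ n + 1) := sub_eq_zero.1 h
    exact_mod_cast h2
  -- Vanishing would make 2·16^n + 1 divide the smaller positive number 16^n.
  have h3 : 2 * (16 : ℤ) ^ n + 1 ∣ 16 ^ n := Dvd.intro_left _ h1.symm
  have h4 : (0 : ℤ) < 16 ^ n := by positivity
  have := Int.le_of_dvd h4 h3
  omega

/-- The coefficients `C_{4n+1,d}`, where `R n` is the imaginary part of
`2 H_{2n}((2+2i)/3) + H_{2n}(2i/3)`. -/
def zetaCoeff (R : ℕ → ℚ) (n d : ℕ) : ℚ :=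
  if d = 0 then 2 * 16 ^ n * 81 ^ n * R n / (cSeq n * (4 * n + 2).factorial)
  else if d = 3 then coeffThree n
  else if d = 4 then -(2 / (cSeq n : ℚ)) * (3 * 81 ^ n + 1)
  else if d = 6 then -(coeffThree n / 16 ^ n) * (2 * 16 ^ n + (-4) ^ n + 1)
  else coeffThree n / 16 ^ n

theorem neg_four_pow_sq (K : Type*) [Field K] (n : ℕ) : ((-4 : K) ^ n) ^ 2 = 16 ^ n := by
  rw [← pow_mul, mul_comm, pow_mul]
  norm_num

theorem sum_zetaCoeff (R : ℕ → ℚ) {n : ℕ} (hn : 1 ≤ n) :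
    ∑ d ∈ ({3, 4, 6, 12} : Finset ℕ), zetaCoeff R n d = -2 := by
  have hc : (cSeq n : ℚ) ≠ 0 := by exact_mod_cast cSeq_ne_zero hn
  have ha : (-4 : ℚ) ^ n ≠ 0 := pow_ne_zero _ (by norm_num)
  have he := neg_four_pow_sq ℚ n
  have hcc := cSeq_cast ℚ n
  simp [zetaCoeff, coeffThree]
  generalize (cSeq n : ℚ) = c at *
  -- With 16^n written as the square of e = (-4)^n, the claim is a rational identity in e, 81^n and
  -- c, closed by the formula for c.
  rw [← he] at *
  generalize (-4 : ℚ) ^ n = e at *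
  field_simp
  rw [hcc]
  ring

theorem zeta_eq_zetaCoeff (R : ℕ → ℚ) {n : ℕ} (hn : 1 ≤ n)
    (hR : (2 * HFun (2 * n) ((2 + 2 * Complex.I) / 3) +
      HFun (2 * n) (2 * Complex.I / 3)).im = R n) :
    riemannZeta ((4 * n + 1 : ℕ) : ℂ) =
      (((zetaCoeff R n 0 : ℝ) * Real.pi ^ (4 * n + 1) +
        ∑ d ∈ ({3, 4, 6, 12} : Finset ℕ),
          (zetaCoeff R n d : ℝ) * lambertS (4 * n + 1) (qOne ^ d) : ℝ) : ℂ) := by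
  have h := lambert_relation hn
  rw [hR] at h
  have hc : (cSeq n : ℂ) ≠ 0 := by exact_mod_cast cSeq_ne_zero hn
  have hcc := cSeq_cast ℂ n
  have he := neg_four_pow_sq ℂ n
  have ha : (-4 : ℂ) ^ n ≠ 0 := pow_ne_zero _ (by norm_num)
  have ht : (81 : ℂ) ^ n ≠ 0 := pow_ne_zero _ (by norm_num)
  have hf : ((4 * n + 2).factorial : ℂ) ≠ 0 := by exact_mod_cast Nat.factorial_ne_zero _
  have p3 : (3 : ℂ) ^ (4 * n + 1) = 3 * 81 ^ n := by rw [pow_succ, pow_mul]; norm_num [mul_comm]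
  have p2 : (2 : ℂ) ^ (4 * n + 1) = 2 * 16 ^ n := by rw [pow_succ, pow_mul]; norm_num [mul_comm]
  have p64 : (-64 / 81 : ℂ) ^ n = (-4) ^ n * 16 ^ n / 81 ^ n := by
    rw [← mul_pow, ← div_pow]; norm_num
  rw [p3, mul_pow 2 (Real.pi : ℂ), p2, p64, div_pow] at h
  simp only [← Complex.ofReal_pow, complexLambert_ofReal] at h
  simp [zetaCoeff, coeffThree]
  push_cast at h
  generalize (cSeq n : ℂ) = c at *
  generalize riemannZeta _ = Z at *
  generalize ((4 * n + 2).factorial : ℂ) = F at *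
  -- From here on zeta, the Lambert values, π^k and the factorial are free symbols: what remains is
  -- to solve the linear relation for zeta.
  generalize (lambertS (4 * n + 1) (qOne ^ 3) : ℂ) = S3 at *
  generalize (lambertS (4 * n + 1) (qOne ^ 4) : ℂ) = S4 at *
  generalize (lambertS (4 * n + 1) (qOne ^ 6) : ℂ) = S6 at *
  generalize (lambertS (4 * n + 1) (qOne ^ 12) : ℂ) = S12 at *
  generalize (Real.pi : ℂ) ^ (4 * n + 1) = P at *
  generalize (R n : ℂ) = r at *
  rw [← he] at *
  generalize (-4 : ℂ) ^ n = e at *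
  generalize (81 : ℂ) ^ n = t at *
  clear he hR p2 p3 p64
  field_simp at h ⊢
  subst hcc
  linear_combination h

theorem zetaCoeff_zero_eq (R : ℕ → ℚ) {n : ℕ} (hn : 1 ≤ n) :
    (((4 * n).factorial : ℝ) * (2 * n + 1) * (4 * n + 3) / 2 ^ (4 * n)) * (cSeq n : ℝ) *
        (zetaCoeff R n 0 : ℝ) = ((4 * n + 3) * 3 ^ (4 * n) / (4 * n + 1)) * (R n : ℝ) := by
  have hc : (cSeq n : ℝ) ≠ 0 := by exact_mod_cast cSeq_ne_zero hn
  have hf : ((4 * n).factorial : ℝ) ≠ 0 := by exact_mod_cast Nat.factorial_ne_zero _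
  have h1 : (4 * n + 1 : ℝ) ≠ 0 := by positivity
  have h2 : (2 * n + 1 : ℝ) ≠ 0 := by positivity
  have p2 : (2 : ℝ) ^ (4 * n) = 16 ^ n := by rw [pow_mul]; norm_num
  have p3 : (3 : ℝ) ^ (4 * n) = 81 ^ n := by rw [pow_mul]; norm_num
  have hfac : ((4 * n + 2).factorial : ℝ) = (2 * (2 * n + 1)) * ((4 * n + 1) * (4 * n).factorial) := by
    rw [Nat.factorial_succ, Nat.factorial_succ]; push_cast; ring
  rw [p2, p3]
  simp only [zetaCoeff, if_true]
  push_cast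
  rw [hfac]
  field_simp

/-- Here `C k 0` is the coefficient of `π ^ k` and `C k d`, for `d ∈ {3, 4, 6, 12}`, is the
coefficient of `S_k(exp (-π d))`, with `k = 4 * n + 1`. -/
theorem mainTheorem3 :
    ∃ C : ℕ → ℕ → ℚ, ∀ n : ℕ, 1 ≤ n →
      -- the evaluation of the zeta value, by convergent Lambert series
      (∀ d ∈ ({3, 4, 6, 12} : Finset ℕ),
        Summable (fun m : ℕ => lambertTerm (4 * n + 1) (qOne ^ d) (m + 1))) ∧
      riemannZeta ((4 * n + 1 : ℕ) : ℂ) =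
        (((C (4 * n + 1) 0 : ℝ) * Real.pi ^ (4 * n + 1) +
          ∑ d ∈ ({3, 4, 6, 12} : Finset ℕ),
            (C (4 * n + 1) d : ℝ) * lambertS (4 * n + 1) (qOne ^ d) : ℝ) : ℂ) ∧
      -- the merit of the four Lambert series, and of the family
      (∀ d ∈ ({3, 4, 6, 12} : Finset ℕ),
        HasMerit (lambertTerm (4 * n + 1) (qOne ^ d)) ((d : ℝ) ^ 2)) ∧
      HasMerit (fun m : ℕ => ∑ d ∈ ({3, 4, 6, 12} : Finset ℕ),
        (C (4 * n + 1) d : ℝ) * lambertTerm (4 * n + 1) (qOne ^ d) m) 9 ∧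
      -- the coefficients of the Lambert series
      cSeq n ≠ 0 ∧
      C (4 * n + 1) 12 = C (4 * n + 1) 3 / 2 ^ (4 * n) ∧
      C (4 * n + 1) 12 =
        (1 - (2 ^ (4 * n + 1) + 1) / (-4) ^ n) * (2 / (cSeq n : ℚ)) ∧
      C (4 * n + 1) 12 ≠ 0 ∧
      C (4 * n + 1) 6 / C (4 * n + 1) 12 = -(2 ^ (4 * n + 1) + (-4) ^ n + 1) ∧
      ∑ d ∈ ({3, 4, 6, 12} : Finset ℕ), C (4 * n + 1) d = -2 ∧
      -- the coefficient of the power of π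
      (((4 * n).factorial : ℝ) * (2 * n + 1) * (4 * n + 3) / 2 ^ (4 * n)) * (cSeq n : ℝ) *
          (C (4 * n + 1) 0 : ℝ) =
        ((4 * n + 3) * 3 ^ (4 * n) / (4 * n + 1)) *
          (2 * HFun (2 * n) ((2 + 2 * Complex.I) / 3) +
            HFun (2 * n) (2 * Complex.I / 3)).im := by
  choose R hR using fun n : ℕ => exists_rat_HFun_im (2 * n)
  -- The coefficients are indexed by k, so n is recovered as (k-1)/4; other values of k get
  -- irrelevant entries.
  refine ⟨fun k d => zetaCoeff R ((k - 1) / 4) d, fun n hn => ?_⟩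
  have hidx : (4 * n + 1 - 1) / 4 = n := by omega
  have hd : ∀ d ∈ ({3, 4, 6, 12} : Finset ℕ), d ≠ 0 := by decide
  have hc : (cSeq n : ℚ) ≠ 0 := by exact_mod_cast cSeq_ne_zero hn
  have h3 := coeffThree_ne_zero hn
  have ha : (16 : ℚ) ^ n ≠ 0 := by positivity
  have he : (-4 : ℚ) ^ n ≠ 0 := pow_ne_zero _ (by norm_num)
  have p2 : (2 : ℚ) ^ (4 * n) = 16 ^ n := by rw [pow_mul]; norm_num
  have e3 : zetaCoeff R n 3 = coeffThree n := by simp [zetaCoeff]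
  have e6 : zetaCoeff R n 6 = -(coeffThree n / 16 ^ n) * (2 * 16 ^ n + (-4) ^ n + 1) := by
    simp [zetaCoeff]
  have e12 : zetaCoeff R n 12 = coeffThree n / 16 ^ n := by simp [zetaCoeff]
  simp only [hidx]
  refine ⟨fun d h => ?_, zeta_eq_zetaCoeff R hn (hR n),
    fun d h => hasMerit_lambertTerm _ (hd d h), ?_, cSeq_ne_zero hn, ?_, ?_, ?_, ?_,
    sum_zetaCoeff R hn, ?_⟩
  · exact summable_lambertTerm _ (pow_nonneg qOne_pos.le d)
      (pow_lt_one₀ qOne_pos.le qOne_lt_one (hd d h))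
  · refine hasMerit_nine_combination _ (C := fun d => (zetaCoeff R n d : ℝ)) ?_
    rw [e3]
    exact_mod_cast h3
  · rw [e3, e12, p2]
  · rw [e12, coeffThree, pow_succ, p2, ← neg_four_pow_sq ℚ n]
    field_simp
  · rw [e12]
    exact div_ne_zero h3 ha
  · rw [e6, e12, pow_succ, p2]
    field_simp
  · rw [zetaCoeff_zero_eq R hn, hR]
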